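/- For complex $a, b, c$ with $c \notin \{0, -1, -2, \dots\}$ and for $|z| < 1$, let $$F(a,b;c;z) = {}_2F_1(a,b;c;z) = \sum_{n=0}^{\infty} \frac{(a)_n (b)_n}{(c)_n} \frac{z^n}{n!}$$ denote the Gauss hypergeometric function, where $(a)_n = a(a+1)\cdots(a+n-1)$ and $(a)_0 = 1$. Then for every real $\lambda$ with $0 < \lambda < 1$, $$F\Big(\frac14, \frac34; 1; 1-\lambda^2\Big) = \sqrt{\frac{2}{1+\lambda}}\; F\Big(\frac12, \frac12; 1; \frac{1-\lambda}{1+\lambda}\Big)$$ and $$F\Big(\frac14, \frac34; 1; \lambda^2\Big) = \sqrt{\frac{1}{1+\lambda}}\; F\Big(\frac12, \frac12; 1; \frac{2\lambda}{1+\lambda}\Big).$$ -/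

import Mathlib

/-!
Averaging the binomial series of `(1 - x g t) ^ (-a)` over a period turns it into a hypergeometric
series whose coefficients are the moments of `g`. Over `[0, 2π]`, the weight `cos t` yields
`F(a/2, (a+1)/2; 1; x²)`, the weight `cos² (t/2)` yields `F(a, 1/2; 1; x)`, and the product
`(1 - u exp (it)) ^ (-a) (1 - v exp (-it)) ^ (-b)` yields `F(a, b; 1; uv)`. The two quadratic
transformations are then the factorizations
`1 - z cos² (t/2) = (1 - z/2) (1 - z/(2 - z) cos t)` and
`(1 - k exp (it)) (1 - k exp (-it)) = (1 + k²) (1 - 2k/(1 + k²) cos t)`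
under the integral sign. Taking `z = 2l/(1 + l)` in the first and `k² = (1 - l)/(1 + l)` in the
second gives the two identities.
-/

open MeasureTheory Set
open Complex (I exp cos)
open scoped Nat Real

section Coefficients

variable {K : Type*} [Field K] [CharZero K]

lemma multichoose_eq_inv_factorial_mul_ascPochhammer (a : K) (n : ℕ) :
    Ring.multichoose a n = (n ! : K)⁻¹ * (ascPochhammer K n).eval a := by
  rw [eq_inv_mul_iff_mul_eq₀ (by exact_mod_cast n.factorial_ne_zero), ← nsmul_eq_mul,
    Ring.factorial_nsmul_multichoose_eq_ascPochhammer, Polynomial.ascPochhammer_smeval_eq_eval]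

lemma multichoose_succ_right (a : K) (n : ℕ) :
    Ring.multichoose a (n + 1) = (a + n) / (n + 1) * Ring.multichoose a n := by
  simp only [multichoose_eq_inv_factorial_mul_ascPochhammer, ascPochhammer_succ_eval,
    Nat.factorial_succ]
  push_cast
  field_simp

lemma multichoose_two_mul_mul_multichoose_half (a : K) (n : ℕ) :
    Ring.multichoose a (2 * n) * Ring.multichoose (1 / 2 : K) n =
      Ring.multichoose (a / 2) n * Ring.multichoose ((a + 1) / 2) n := by
  induction n with
  | zero => simp
  | succ n ih =>
    have hn : (2 * n + 1 : K) ≠ 0 := by exact_mod_cast (2 * n).succ_ne_zero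
    have hn' : (n + 1 : K) ≠ 0 := by exact_mod_cast n.succ_ne_zero
    have hn2 : (2 * n + 1 + 1 : K) ≠ 0 := by exact_mod_cast (2 * n + 1).succ_ne_zero
    calc Ring.multichoose a (2 * (n + 1)) * Ring.multichoose (1 / 2 : K) (n + 1)
        = (a / 2 + n) / (n + 1) * (((a + 1) / 2 + n) / (n + 1)) *
            (Ring.multichoose a (2 * n) * Ring.multichoose (1 / 2 : K) n) := by
          rw [mul_add_one, multichoose_succ_right, multichoose_succ_right, multichoose_succ_right]
          push_cast
          field_simp
          ring
      _ = Ring.multichoose (a / 2) (n + 1) * Ring.multichoose ((a + 1) / 2) (n + 1) := by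
          rw [ih, multichoose_succ_right, multichoose_succ_right]
          ring

lemma ordinaryHypergeometric_one_eq_tsum_multichoose {A : Type*} [Ring A] [Algebra K A]
    [TopologicalSpace A] [IsTopologicalRing A] (a b : K) (x : A) :
    ₂F₁ a b (1 : K) x = ∑' n, (Ring.multichoose a n * Ring.multichoose b n) • x ^ n := by
  rw [ordinaryHypergeometric_eq_tsum]
  refine tsum_congr fun n ↦ ?_
  rw [ascPochhammer_eval_one, multichoose_eq_inv_factorial_mul_ascPochhammer,
    multichoose_eq_inv_factorial_mul_ascPochhammer]
  exact congrArg (· • _) (by ring)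

end Coefficients

lemma ofReal_ordinaryHypergeometric (a b c x : ℝ) :
    ((₂F₁ a b c x : ℝ) : ℂ) = ₂F₁ (a : ℂ) (b : ℂ) (c : ℂ) (x : ℂ) := by
  have eval_ofReal (n : ℕ) (y : ℝ) :
      (ascPochhammer ℂ n).eval (y : ℂ) = ((ascPochhammer ℝ n).eval y : ℝ) := by
    rw [← ascPochhammer_map Complex.ofRealHom, ← Complex.ofRealHom_eq_coe,
      Polynomial.eval_map_apply, Complex.ofRealHom_eq_coe]
  simp only [ordinaryHypergeometric_eq_tsum, Complex.ofReal_tsum, smul_eq_mul, eval_ofReal]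
  push_cast
  rfl

lemma ofReal_multichoose (r : ℝ) (n : ℕ) :
    ((Ring.multichoose r n : ℝ) : ℂ) = Ring.multichoose (r : ℂ) n :=
  Ring.map_multichoose Complex.ofRealHom r n

lemma re_one_sub_pos_of_norm_lt_one {z : ℂ} (hz : ‖z‖ < 1) : 0 < (1 - z).re := by
  simpa using (Complex.re_le_norm z).trans_lt hz

lemma mul_cpow_of_re_pos {z w : ℂ} (hz : 0 < z.re) (hw : 0 < w.re) (a : ℂ) :
    (z * w) ^ a = z ^ a * w ^ a := by
  have hz₀ : z ≠ 0 := fun h ↦ by simp [h] at hz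
  have hw₀ : w ≠ 0 := fun h ↦ by simp [h] at hw
  have harg : z.arg + w.arg ∈ Ioc (-π) π := by
    have hz' := abs_lt.mp (Complex.abs_arg_lt_pi_div_two_iff.mpr (.inl hz))
    have hw' := abs_lt.mp (Complex.abs_arg_lt_pi_div_two_iff.mpr (.inl hw))
    constructor <;> linarith
  rw [Complex.cpow_def_of_ne_zero (mul_ne_zero hz₀ hw₀), Complex.cpow_def_of_ne_zero hz₀,
    Complex.cpow_def_of_ne_zero hw₀, Complex.log_mul hz₀ hw₀ harg, add_mul, Complex.exp_add]

lemma hasSum_multichoose_mul_pow (a : ℂ) {z : ℂ} (hz : ‖z‖ < 1) :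
    HasSum (fun n ↦ Ring.multichoose a n * z ^ n) ((1 - z) ^ (-a)) := by
  have h := (Complex.one_div_one_sub_cpow_hasFPowerSeriesOnBall_zero a).hasSum
    (y := z) (by simpa [enorm_eq_nnnorm, ← NNReal.coe_lt_coe] using hz)
  simpa [← Ring.multichoose_eq, FormalMultilinearSeries.ofScalars_apply_eq, Complex.cpow_neg,
    mul_comm] using h

lemma norm_mul_lt_one_of_norm_le_one {R : Type*} [NonUnitalSeminormedRing R] {x y : R}
    (hx : ‖x‖ < 1) (hy : ‖y‖ ≤ 1) : ‖x * y‖ < 1 :=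
  (norm_mul_le x y).trans_lt ((mul_le_of_le_one_right (norm_nonneg x) hy).trans_lt hx)

lemma re_one_sub_mul_pos {x y : ℂ} (hx : ‖x‖ < 1) (hy : ‖y‖ ≤ 1) : 0 < (1 - x * y).re :=
  re_one_sub_pos_of_norm_lt_one (norm_mul_lt_one_of_norm_le_one hx hy)

lemma continuous_one_sub_mul_cpow (a : ℂ) {x : ℂ} (hx : ‖x‖ < 1) {g : ℝ → ℂ} (hg : Continuous g)
    (hg_le : ∀ t, ‖g t‖ ≤ 1) : Continuous fun t ↦ (1 - x * g t) ^ a :=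
  (by fun_prop : Continuous fun t ↦ 1 - x * g t).cpow continuous_const fun t ↦
    .inl (re_one_sub_mul_pos hx (hg_le t))

lemma norm_cos_ofReal_le_one (t : ℝ) : ‖cos t‖ ≤ 1 := by
  rw [← Complex.ofReal_cos, Complex.norm_real]
  exact Real.abs_cos_le_one t

lemma norm_exp_ofReal_mul_I_le_one (t : ℝ) : ‖exp (t * I)‖ ≤ 1 :=
  (Complex.norm_exp_ofReal_mul_I t).le

lemma norm_exp_neg_ofReal_mul_I_le_one (t : ℝ) : ‖exp (-(t * I))‖ ≤ 1 := by
  simpa using norm_exp_ofReal_mul_I_le_one (-t)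

lemma hasSum_integral_one_sub_mul_cpow_neg_mul (a : ℂ) {x : ℂ} (hx : ‖x‖ < 1) {μ : Measure ℝ}
    {p q : ℝ} {g h : ℝ → ℂ} (hg : Continuous g) (hg_le : ∀ t, ‖g t‖ ≤ 1)
    (hh : IntervalIntegrable h μ p q) :
    HasSum (fun n ↦ Ring.multichoose a n * x ^ n * ∫ t in p..q, g t ^ n * h t ∂μ)
      (∫ t in p..q, (1 - x * g t) ^ (-a) * h t ∂μ) := by
  have hsum : Summable fun n ↦ ‖Ring.multichoose a n * x ^ n‖ :=
    (hasSum_multichoose_mul_pow a hx).summable.norm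
  simp only [← intervalIntegral.integral_const_mul]
  refine intervalIntegral.hasSum_integral_of_dominated_convergence
    (fun n t ↦ ‖Ring.multichoose a n * x ^ n‖ * ‖h t‖) (fun n ↦ ?_)
    (fun n ↦ .of_forall fun t _ ↦ ?_) (.of_forall fun t _ ↦ hsum.mul_right _) ?_
    (.of_forall fun t _ ↦ ?_)
  · exact ((hg.pow n).aestronglyMeasurable.mul hh.def'.aestronglyMeasurable).const_mul _
  · rw [norm_mul, norm_mul (g t ^ n), norm_pow (g t)]
    gcongr
    exact mul_le_of_le_one_left (norm_nonneg _) (pow_le_one₀ (norm_nonneg _) (hg_le t))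
  · simp only [tsum_mul_right]
    exact hh.norm.const_mul _
  · have h_binom := hasSum_multichoose_mul_pow a (norm_mul_lt_one_of_norm_le_one hx (hg_le t))
    simpa only [mul_pow, mul_assoc] using h_binom.mul_right (h t)

lemma integral_cos_pow_even_of_sin_eq_zero {b : ℝ} (hb : Real.sin b = 0) (n : ℕ) :
    ∫ t in (0)..b, Real.cos t ^ (2 * n) = b * Ring.multichoose (1 / 2 : ℝ) n := by
  induction n with
  | zero => simp
  | succ n ih =>
    rw [mul_add_one, integral_cos_pow, ih, multichoose_succ_right, hb, Real.sin_zero]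
    push_cast
    field_simp
    ring

lemma integral_cos_pow_odd_of_sin_eq_zero {b : ℝ} (hb : Real.sin b = 0) (n : ℕ) :
    ∫ t in (0)..b, Real.cos t ^ (2 * n + 1) = 0 := by
  induction n with
  | zero => simp [hb]
  | succ n ih =>
    rw [show 2 * (n + 1) + 1 = 2 * n + 1 + 2 by ring, integral_cos_pow, ih, hb, Real.sin_zero]
    simp

lemma integral_exp_int_mul_I (m : ℤ) :
    ∫ t in (0)..(2 * π), exp (m * I * t) = if m = 0 then 2 * (π : ℂ) else 0 := by
  split_ifs with hm
  · simp [hm]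
  · rw [integral_exp_mul_complex (by simpa using hm)]
    have h_period : exp (m * I * ↑(2 * π)) = 1 :=
      Complex.exp_eq_one_iff.mpr ⟨m, by push_cast; ring⟩
    rw [h_period]
    simp

lemma integral_one_sub_mul_cos_cpow_neg (a : ℂ) {x : ℂ} (hx : ‖x‖ < 1) :
    ∫ t in (0)..(2 * π), (1 - x * cos t) ^ (-a) =
      2 * π * ₂F₁ (a / 2) ((a + 1) / 2) (1 : ℂ) (x ^ 2) := by
  have h := hasSum_integral_one_sub_mul_cpow_neg_mul a hx (μ := volume) (p := 0) (q := 2 * π)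
    (g := fun t ↦ (Real.cos t : ℂ)) (h := fun _ ↦ 1) (by fun_prop)
    (fun t ↦ by simpa only [Complex.ofReal_cos] using norm_cos_ofReal_le_one t)
    intervalIntegrable_const
  simp only [mul_one, ← Complex.ofReal_pow, intervalIntegral.integral_ofReal] at h
  rw [← (mul_right_injective₀ (two_ne_zero' ℕ)).hasSum_iff] at h
  · simp only [Complex.ofReal_cos] at h
    rw [← h.tsum_eq, ordinaryHypergeometric_one_eq_tsum_multichoose, ← tsum_mul_left]
    refine tsum_congr fun n ↦ ?_
    rw [Function.comp_apply, integral_cos_pow_even_of_sin_eq_zero Real.sin_two_pi,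
      ← multichoose_two_mul_mul_multichoose_half, smul_eq_mul]
    push_cast [ofReal_multichoose]
    ring
  · intro n hn
    obtain ⟨m, rfl | rfl⟩ := n.even_or_odd'
    · exact absurd ⟨m, rfl⟩ hn
    · rw [integral_cos_pow_odd_of_sin_eq_zero Real.sin_two_pi, Complex.ofReal_zero, mul_zero]

lemma integral_one_sub_mul_cos_half_sq_cpow_neg (a : ℂ) {x : ℂ} (hx : ‖x‖ < 1) :
    ∫ t in (0)..(2 * π), (1 - x * cos (t / 2) ^ 2) ^ (-a) =
      2 * π * ₂F₁ a (1 / 2) (1 : ℂ) x := by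
  have hcos_sq (t : ℝ) : ‖((Real.cos (t / 2) ^ 2 : ℝ) : ℂ)‖ ≤ 1 := by
    rw [Complex.norm_real, Real.norm_of_nonneg (sq_nonneg _)]
    exact Real.cos_sq_le_one _
  have h := hasSum_integral_one_sub_mul_cpow_neg_mul a hx (μ := volume) (p := 0) (q := 2 * π)
    (g := fun t ↦ ((Real.cos (t / 2) ^ 2 : ℝ) : ℂ)) (h := fun _ ↦ 1) (by fun_prop)
    hcos_sq intervalIntegrable_const
  have hmoment (n : ℕ) : ∫ t in (0)..(2 * π), (Real.cos (t / 2) ^ 2) ^ n =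
      2 * π * Ring.multichoose (1 / 2 : ℝ) n := by
    simp only [← pow_mul]
    rw [intervalIntegral.integral_comp_div (fun s ↦ Real.cos s ^ (2 * n)) two_ne_zero, zero_div,
      mul_div_cancel_left₀ _ two_ne_zero, integral_cos_pow_even_of_sin_eq_zero Real.sin_pi,
      smul_eq_mul, mul_assoc]
  simp only [mul_one, ← Complex.ofReal_pow, intervalIntegral.integral_ofReal, hmoment] at h
  push_cast [ofReal_multichoose] at h
  rw [← h.tsum_eq, ordinaryHypergeometric_one_eq_tsum_multichoose, ← tsum_mul_left]
  exact tsum_congr fun n ↦ by rw [smul_eq_mul]; ring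

lemma integral_exp_pow_mul_exp_neg_pow (m n : ℕ) :
    ∫ t in (0)..(2 * π), exp (-(t * I)) ^ m * exp (t * I) ^ n =
      if m = n then 2 * (π : ℂ) else 0 := by
  have h := integral_exp_int_mul_I (n - m)
  simp only [sub_eq_zero, Nat.cast_inj, eq_comm (a := n)] at h
  rw [← h]
  congr 1 with t
  rw [← Complex.exp_nat_mul, ← Complex.exp_nat_mul, ← Complex.exp_add]
  push_cast
  ring_nf

lemma integral_one_sub_mul_exp_neg_cpow_neg_mul_exp_pow (b : ℂ) {v : ℂ} (hv : ‖v‖ < 1) (n : ℕ) :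
    ∫ t in (0)..(2 * π), (1 - v * exp (-(t * I))) ^ (-b) * exp (t * I) ^ n =
      2 * π * (Ring.multichoose b n * v ^ n) := by
  have h := hasSum_integral_one_sub_mul_cpow_neg_mul b hv (μ := volume) (p := 0) (q := 2 * π)
    (g := fun t ↦ exp (-(t * I))) (h := fun t ↦ exp (t * I) ^ n) (by fun_prop)
    norm_exp_neg_ofReal_mul_I_le_one (Continuous.intervalIntegrable (by fun_prop) _ _)
  simp only [integral_exp_pow_mul_exp_neg_pow, mul_ite, mul_zero] at h
  rw [← h.tsum_eq, tsum_ite_eq, mul_comm]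

lemma integral_one_sub_mul_exp_cpow_neg_mul (a b : ℂ) {u v : ℂ} (hu : ‖u‖ < 1) (hv : ‖v‖ < 1) :
    ∫ t in (0)..(2 * π), (1 - u * exp (t * I)) ^ (-a) * (1 - v * exp (-(t * I))) ^ (-b) =
      2 * π * ₂F₁ a b (1 : ℂ) (u * v) := by
  have hcont : Continuous fun t : ℝ ↦ (1 - v * exp (-(t * I))) ^ (-b) :=
    continuous_one_sub_mul_cpow (-b) hv (by fun_prop) norm_exp_neg_ofReal_mul_I_le_one
  have h := hasSum_integral_one_sub_mul_cpow_neg_mul a hu (μ := volume) (p := 0) (q := 2 * π)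
    (g := fun t ↦ exp (t * I)) (by fun_prop)
    norm_exp_ofReal_mul_I_le_one (hcont.intervalIntegrable _ _)
  simp only [mul_comm (exp _ ^ _), integral_one_sub_mul_exp_neg_cpow_neg_mul_exp_pow _ hv] at h
  rw [← h.tsum_eq, ordinaryHypergeometric_one_eq_tsum_multichoose, ← tsum_mul_left]
  exact tsum_congr fun n ↦ by rw [smul_eq_mul]; ring

theorem ordinaryHypergeometric_half_one (a : ℂ) {z : ℂ} (hz : ‖z‖ < 1) :
    ₂F₁ a (1 / 2) (1 : ℂ) z =
      (1 - z / 2) ^ (-a) * ₂F₁ (a / 2) ((a + 1) / 2) (1 : ℂ) ((z / (2 - z)) ^ 2) := by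
  have h_norm : 1 < ‖2 - z‖ := by
    have := norm_sub_norm_le (2 : ℂ) z
    rw [Complex.norm_ofNat] at this
    linarith
  have h_ne : 2 - z ≠ 0 := norm_pos_iff.mp (one_pos.trans h_norm)
  have hx : ‖z / (2 - z)‖ < 1 := by
    rw [norm_div, div_lt_one (one_pos.trans h_norm)]
    exact hz.trans h_norm
  have hz2 : ‖z / 2‖ < 1 := by
    rw [norm_div, Complex.norm_ofNat]
    linarith [norm_nonneg z]
  have h_factor (t : ℝ) : (1 - z * cos (t / 2) ^ 2) ^ (-a) =
      (1 - z / 2) ^ (-a) * (1 - z / (2 - z) * cos t) ^ (-a) := by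
    rw [← mul_cpow_of_re_pos (re_one_sub_pos_of_norm_lt_one hz2)
      (re_one_sub_mul_pos hx (norm_cos_ofReal_le_one t))]
    have h_cos : cos t = 2 * cos (t / 2) ^ 2 - 1 := by
      rw [← Complex.cos_two_mul, mul_div_cancel₀ _ two_ne_zero]
    rw [h_cos]
    congr 1
    field_simp
    ring
  have h_two_pi : 2 * (π : ℂ) ≠ 0 := by exact_mod_cast Real.two_pi_pos.ne'
  refine mul_left_cancel₀ h_two_pi ?_
  rw [mul_left_comm, ← integral_one_sub_mul_cos_cpow_neg a hx,
    ← integral_one_sub_mul_cos_half_sq_cpow_neg a hz, ← intervalIntegral.integral_const_mul]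
  simp only [h_factor]

theorem ordinaryHypergeometric_self_one (a : ℂ) {z : ℂ} (hz : ‖z‖ < 1)
    (hz' : ‖4 * z / (1 + z) ^ 2‖ < 1) :
    ₂F₁ a a (1 : ℂ) z =
      (1 + z) ^ (-a) * ₂F₁ (a / 2) ((a + 1) / 2) (1 : ℂ) (4 * z / (1 + z) ^ 2) := by
  obtain ⟨k, rfl⟩ := IsAlgClosed.exists_pow_nat_eq z two_pos
  have hsq : 4 * k ^ 2 / (1 + k ^ 2) ^ 2 = (2 * k / (1 + k ^ 2)) ^ 2 := by
    rw [div_pow, mul_pow]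
    norm_num
  have hk : ‖k‖ < 1 := by simpa using hz
  have hx : ‖2 * k / (1 + k ^ 2)‖ < 1 := by
    rwa [hsq, norm_pow, sq_lt_one_iff₀ (norm_nonneg _)] at hz'
  have h_re : 0 < (1 + k ^ 2).re := by
    simpa using re_one_sub_pos_of_norm_lt_one (z := -k ^ 2) (by simpa)
  have h_ne : 1 + k ^ 2 ≠ 0 := fun h ↦ by simp [h] at h_re
  have h_factor (t : ℝ) : (1 - k * exp (t * I)) ^ (-a) * (1 - k * exp (-(t * I))) ^ (-a) =
      (1 + k ^ 2) ^ (-a) * (1 - 2 * k / (1 + k ^ 2) * cos t) ^ (-a) := by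
    rw [← mul_cpow_of_re_pos (re_one_sub_mul_pos hk (norm_exp_ofReal_mul_I_le_one t))
        (re_one_sub_mul_pos hk (norm_exp_neg_ofReal_mul_I_le_one t)),
      ← mul_cpow_of_re_pos h_re (re_one_sub_mul_pos hx (norm_cos_ofReal_le_one t))]
    have h_exp : exp (t * I) * exp (-(t * I)) = 1 := by
      rw [← Complex.exp_add, add_neg_cancel, Complex.exp_zero]
    congr 1
    rw [Complex.cos, neg_mul]
    field_simp
    linear_combination k ^ 2 * h_exp
  have h_two_pi : 2 * (π : ℂ) ≠ 0 := by exact_mod_cast Real.two_pi_pos.ne'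
  refine mul_left_cancel₀ h_two_pi ?_
  rw [hsq, mul_left_comm, ← integral_one_sub_mul_cos_cpow_neg a hx, sq,
    ← integral_one_sub_mul_exp_cpow_neg_mul a a hk hk, ← intervalIntegral.integral_const_mul]
  simp only [h_factor, sq]

theorem ordinaryHypergeometric_one_sub_sq (a : ℂ) {l : ℂ} (hre : 0 < l.re) (hl : ‖1 - l ^ 2‖ < 1) :
    ₂F₁ (a / 2) ((a + 1) / 2) (1 : ℂ) (1 - l ^ 2) =
      (2 / (1 + l)) ^ a * ₂F₁ a a (1 : ℂ) ((1 - l) / (1 + l)) := by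
  have h_ne : 1 + l ≠ 0 := fun h ↦ by
    have h_re := congrArg Complex.re h
    simp only [Complex.add_re, Complex.one_re, Complex.zero_re] at h_re
    linarith
  have hz : ‖(1 - l) / (1 + l)‖ < 1 := by
    rw [norm_div, div_lt_one (norm_pos_iff.mpr h_ne), ← sq_lt_sq₀ (norm_nonneg _) (norm_nonneg _),
      Complex.sq_norm, Complex.sq_norm, Complex.normSq_apply, Complex.normSq_apply]
    simp only [Complex.add_re, Complex.sub_re, Complex.one_re, Complex.add_im, Complex.sub_im,
      Complex.one_im]
    linarith
  have h_add : 1 + (1 - l) / (1 + l) = 2 / (1 + l) := by field_simp; ring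
  have h_arg : 4 * ((1 - l) / (1 + l)) / (2 / (1 + l)) ^ 2 = 1 - l ^ 2 := by field_simp; ring
  rw [ordinaryHypergeometric_self_one a hz (by rwa [h_add, h_arg]), h_add, h_arg,
    Complex.cpow_neg, mul_inv_cancel_left₀ (by simp [Complex.cpow_eq_zero_iff, h_ne])]

theorem ordinaryHypergeometric_sq (a : ℂ) {l : ℂ} (hl : ‖2 * l‖ < ‖1 + l‖) :
    ₂F₁ (a / 2) ((a + 1) / 2) (1 : ℂ) (l ^ 2) =
      (1 / (1 + l)) ^ a * ₂F₁ a (1 / 2) (1 : ℂ) (2 * l / (1 + l)) := by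
  have h_ne : 1 + l ≠ 0 := norm_pos_iff.mp ((norm_nonneg _).trans_lt hl)
  have hz : ‖2 * l / (1 + l)‖ < 1 := by rwa [norm_div, div_lt_one (norm_pos_iff.mpr h_ne)]
  have h_sub : 1 - 2 * l / (1 + l) / 2 = 1 / (1 + l) := by field_simp; ring
  have h_two_sub : 2 - 2 * l / (1 + l) = 2 / (1 + l) := by field_simp; ring
  have h_arg : 2 * l / (1 + l) / (2 / (1 + l)) = l := by field_simp
  rw [ordinaryHypergeometric_half_one a hz, h_sub, h_two_sub, h_arg,
    Complex.cpow_neg, mul_inv_cancel_left₀ (by simp [Complex.cpow_eq_zero_iff, h_ne])]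

theorem mainTheorem3_general (a l : ℂ) :
    (0 < l.re → ‖1 - l ^ 2‖ < 1 →
      ₂F₁ (a / 2) ((a + 1) / 2) (1 : ℂ) (1 - l ^ 2) =
        (2 / (1 + l)) ^ a * ₂F₁ a a (1 : ℂ) ((1 - l) / (1 + l))) ∧
      (‖2 * l‖ < ‖1 + l‖ →
        ₂F₁ (a / 2) ((a + 1) / 2) (1 : ℂ) (l ^ 2) =
          (1 / (1 + l)) ^ a * ₂F₁ a (1 / 2) (1 : ℂ) (2 * l / (1 + l))) :=
  ⟨ordinaryHypergeometric_one_sub_sq a, ordinaryHypergeometric_sq a⟩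

lemma ordinaryHypergeometric_one_sub_sq_real (a : ℝ) {l : ℝ} (hl₀ : 0 < l) (hl : l ^ 2 < 2) :
    ₂F₁ (a / 2) ((a + 1) / 2) (1 : ℝ) (1 - l ^ 2) =
      (2 / (1 + l)) ^ a * ₂F₁ a a (1 : ℝ) ((1 - l) / (1 + l)) := by
  have h_norm : ‖(1 - l ^ 2 : ℂ)‖ < 1 := by
    norm_cast
    exact abs_lt.mpr ⟨by linarith, by linarith [pow_pos hl₀ 2]⟩
  have h := (mainTheorem3_general a l).1 (by simpa) h_norm
  refine Complex.ofReal_injective ?_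
  push_cast [ofReal_ordinaryHypergeometric, Complex.ofReal_cpow (by positivity : 0 ≤ 2 / (1 + l))]
  exact h

lemma ordinaryHypergeometric_sq_real (a : ℝ) {l : ℝ} (hl₀ : -(1 / 3) < l) (hl₁ : l < 1) :
    ₂F₁ (a / 2) ((a + 1) / 2) (1 : ℝ) (l ^ 2) =
      (1 / (1 + l)) ^ a * ₂F₁ a (1 / 2) (1 : ℝ) (2 * l / (1 + l)) := by
  have h_pos : 0 < 1 + l := by linarith
  have h_norm : ‖(2 * l : ℂ)‖ < ‖(1 + l : ℂ)‖ := by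
    norm_cast
    rw [Real.norm_of_nonneg h_pos.le]
    exact abs_lt.mpr ⟨by linarith, by linarith⟩
  have h := (mainTheorem3_general a l).2 h_norm
  refine Complex.ofReal_injective ?_
  push_cast [ofReal_ordinaryHypergeometric, Complex.ofReal_cpow (by positivity : 0 ≤ 1 / (1 + l))]
  exact h

theorem mainTheorem3 (l : ℝ) (hl : l ∈ Set.Ioo (0 : ℝ) 1) :
    ₂F₁ (1 / 4 : ℝ) (3 / 4 : ℝ) (1 : ℝ) (1 - l ^ 2) =
        √(2 / (1 + l)) * ₂F₁ (1 / 2 : ℝ) (1 / 2 : ℝ) (1 : ℝ) ((1 - l) / (1 + l)) ∧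
      ₂F₁ (1 / 4 : ℝ) (3 / 4 : ℝ) (1 : ℝ) (l ^ 2) =
        √(1 / (1 + l)) * ₂F₁ (1 / 2 : ℝ) (1 / 2 : ℝ) (1 : ℝ) (2 * l / (1 + l)) := by
  obtain ⟨hl₀, hl₁⟩ := hl
  have h_quarter : (1 / 4 : ℝ) = 1 / 2 / 2 := by norm_num
  have h_three_quarters : (3 / 4 : ℝ) = (1 / 2 + 1) / 2 := by norm_num
  rw [h_quarter, h_three_quarters, Real.sqrt_eq_rpow, Real.sqrt_eq_rpow]
  exact ⟨ordinaryHypergeometric_one_sub_sq_real (1 / 2) hl₀ (by nlinarith),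
    ordinaryHypergeometric_sq_real (1 / 2) (by linarith) hl₁⟩
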